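/- Let $n,d\ge 1$ be integers. For integers $m\ge 0$ write $\binom{m}{\le d}=\sum_{i=0}^{d}\binom{m}{i}$. Let $\mathcal P_{n,d}$ be the set of polynomials in $\mathbb F_2[X_1,\dots,X_n]$ of total degree at most $d$ and of degree at most $1$ in each variable. For $S\subseteq\mathbb F_2^n$ let $\mathrm h_S(d,\mathbb F_2)$ be the affine Hilbert function of $S$, i.e. the dimension over $\mathbb F_2$ of the space $\{p|_S : p\in\mathbb F_2[X_1,\dots,X_n],\ \deg p\le d\}\subseteq \mathbb F_2^S$. Identify $\{0,1\}^n$ with $\mathbb F_2^n$. (1) For every nonempty $S\subseteq\mathbb F_2^n$ and every function $f:S\to\mathbb F_2$, a uniformly random $p\in\mathcal P_{n,d}$ satisfies $$\Pr_{p}\big[p|_S=f\big]\;\le\;2^{-\mathrm h_S(d,\mathbb F_2)}\;\le\;2^{-\binom{\lfloor\log_2|S|\rfloor}{\le d}}.$$ (2) Let $k\ge 1$ be an integer and let $\mathcal X$ be a finite family of probability distributions on $\{0,1\}^n$, each of min-entropy $\mathrm H_\infty(\mathbf X)=\min_{x\in\mathrm{support}(\mathbf X)}\big(-\log_2\Pr[\mathbf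 X=x]\big)$ at least $k$. Then a uniformly random $p\in\mathcal P_{n,d}$ is a disperser for $\mathcal X$, meaning that $p(\mathbf X)$ has support $\{0,1\}$ for every $\mathbf X\in\mathcal X$, with probability at least $$1-|\mathcal X|\cdot 2^{\,1-\binom{k}{\le d}}.$$ -/

import Mathlib

noncomputable section

/-- The number `binom(m, ≤ d) = ∑_{i = 0}^{d} binom(m, i)`. -/
def chooseLe (m d : ℕ) : ℕ := ∑ i ∈ Finset.range (d + 1), m.choose i

/-- Restriction `p ↦ p|_S` of polynomials to a set `S ⊆ Fⁿ`, as a linear map into `F^S`. -/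
def restrictTo {F : Type*} [Field F] {n : ℕ} (S : Set (Fin n → F)) :
    MvPolynomial (Fin n) F →ₗ[F] (S → F) :=
  LinearMap.pi fun x => (MvPolynomial.aeval (x : Fin n → F)).toLinearMap

theorem restrictTo_apply {F : Type*} [Field F] {n : ℕ} (S : Set (Fin n → F))
    (p : MvPolynomial (Fin n) F) (x : S) :
    restrictTo S p x = MvPolynomial.eval (x : Fin n → F) p := by
  simp [restrictTo, MvPolynomial.aeval_eq_eval]

/-- The affine Hilbert function `h_S(d, F)`: the dimension of the space of all restrictions to `S`
of polynomials of total degree at most `d`. -/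
def hilbertFunction {F : Type*} [Field F] {n : ℕ} (S : Set (Fin n → F)) (d : ℕ) : ℕ :=
  Module.finrank F ((MvPolynomial.restrictTotalDegree (Fin n) F d).map (restrictTo S))

/-- The polynomials in `n` variables over a finite field `F` with `q` elements, of total degree
at most `d` and of individual degrees at most `q - 1`. -/
def lowDegreePoly (F : Type*) [Field F] [Fintype F] (n d : ℕ) :
    Submodule F (MvPolynomial (Fin n) F) :=
  MvPolynomial.restrictTotalDegree (Fin n) F d ⊓
    MvPolynomial.restrictDegree (Fin n) F (Fintype.card F - 1)

instance lowDegreePoly_finite (F : Type*) [Field F] [Fintype F] (n d : ℕ) :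
    Finite (lowDegreePoly F n d) := by
  have h : Finite (MvPolynomial.restrictTotalDegree (Fin n) F d) := Module.finite_of_finite F
  exact Finite.of_injective
    (Submodule.inclusion (inf_le_left :
      lowDegreePoly F n d ≤ MvPolynomial.restrictTotalDegree (Fin n) F d))
    (Submodule.inclusion_injective _)

instance lowDegreePoly_fintype (F : Type*) [Field F] [Fintype F] (n d : ℕ) :
    Fintype (lowDegreePoly F n d) := Fintype.ofFinite _

/-- The probability that a uniformly random element `p` of `lowDegreePoly F n d` satisfies `P`. -/
def prRandomPoly (F : Type*) [Field F] [Fintype F] (n d : ℕ)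
    (P : MvPolynomial (Fin n) F → Prop) : ℝ :=
  ((PMF.uniformOfFintype (lowDegreePoly F n d)).toOuterMeasure {p | P p}).toReal

/-- The min-entropy `min_{x ∈ support X} -log₂ Pr[X = x]` of a distribution on a finite type. -/
def minEntropy {α : Type*} [Fintype α] (X : PMF α) : ℝ :=
  ⨅ x : X.support, -Real.logb 2 (X x).toReal

/-- `f : {0,1}ⁿ → {0,1}` is a disperser for a family of distributions if `f(X)` has
support `{0,1}` for every member `X`. Here `{0,1}` is identified with `ZMod 2`. -/
def IsDisperser {n : ℕ} (f : (Fin n → ZMod 2) → ZMod 2)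
    (𝒳 : Set (PMF (Fin n → ZMod 2))) : Prop :=
  ∀ X ∈ 𝒳, (X.map f).support = {0, 1}

end

/-! The key bound is `lightCount |S| (d + 1) ≤ hilbertFunction S d`, proved by induction on `n`. Let
`A` and `B` be the union and intersection of the two slices of `S` along the first coordinate, so
`|A| + |B| = |S|`. Polynomials not involving that coordinate contribute `h_A(d + 1)` dimensions to
`h_S(d + 1)`. They are killed by differencing along the coordinate, while products `X 0 * q` with
`deg q ≤ d` difference to `q` on `B`, which gives `h_B(d)` more. `lightCount_add_le` is the matching
recursion on the counting side, and at `|S| = 2 ^ k` the count is a binomial sum. Fibres of the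
restriction map are empty or cosets of its kernel, which gives (1). For (2), failure on a source
means that `p` is constant on a support of size at least `2 ^ k`; a union bound finishes. -/

/-! ### Counting integers of small binary digit sum. -/

/-- The number of `i < s` whose binary expansion has fewer than `e` ones. -/
def lightCount (s e : ℕ) : ℕ :=
  ∑ i ∈ Finset.range s, if (Nat.digits 2 i).sum < e then 1 else 0

theorem lightCount_succ (s e : ℕ) :
    lightCount (s + 1) e = lightCount s e + if (Nat.digits 2 s).sum < e then 1 else 0 :=
  Finset.sum_range_succ _ _

theorem lightCount_zero_right (s : ℕ) : lightCount s 0 = 0 := by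
  simp [lightCount]

theorem lightCount_zero_left (e : ℕ) : lightCount 0 e = 0 := by
  simp [lightCount]

theorem lightCount_one (d : ℕ) : lightCount 1 (d + 1) = 1 := by
  rw [← zero_add 1, lightCount_succ, lightCount_zero_left]
  simp

theorem lightCount_mono {s t : ℕ} (h : s ≤ t) (e : ℕ) : lightCount s e ≤ lightCount t e :=
  Finset.sum_le_sum_of_subset (Finset.range_subset_range.2 h)

theorem sum_digits_two_mul (i : ℕ) : (Nat.digits 2 (2 * i)).sum = (Nat.digits 2 i).sum := by
  rcases Nat.eq_zero_or_pos i with rfl | hi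
  · simp
  · have h := Nat.digits_add 2 (by norm_num) 0 i (by norm_num) (Or.inr hi.ne')
    rw [zero_add] at h
    simp [h]

theorem sum_digits_two_mul_add_one (i : ℕ) :
    (Nat.digits 2 (2 * i + 1)).sum = (Nat.digits 2 i).sum + 1 := by
  have h := Nat.digits_add 2 (by norm_num) 1 i (by norm_num) (Or.inl one_ne_zero)
  rw [add_comm 1] at h
  rw [h, List.sum_cons, add_comm]

theorem lightCount_two_mul (m e : ℕ) :
    lightCount (2 * m) e = lightCount m e + lightCount m (e - 1) := by
  induction m with
  | zero => simp [lightCount_zero_left]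
  | succ m ih =>
    rw [show 2 * (m + 1) = 2 * m + 1 + 1 by ring, lightCount_succ, lightCount_succ, ih,
      lightCount_succ, lightCount_succ, sum_digits_two_mul, sum_digits_two_mul_add_one]
    simp only [Nat.lt_sub_iff_add_lt]
    ring

theorem lightCount_two_mul_add_one (m e : ℕ) :
    lightCount (2 * m + 1) e = lightCount (m + 1) e + lightCount m (e - 1) := by
  rw [lightCount_succ, lightCount_two_mul, lightCount_succ, sum_digits_two_mul]
  ring

theorem lightCount_exchange (q e : ℕ) :
    lightCount q e + lightCount (q + 1) (e - 1) ≤ lightCount (q + 1) e + lightCount q (e - 1) := by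
  rw [lightCount_succ, lightCount_succ]
  have : (if (Nat.digits 2 q).sum < e - 1 then 1 else 0) ≤
      if (Nat.digits 2 q).sum < e then 1 else 0 := by
    split_ifs <;> omega
  omega

/-- Halving `a` and `b` reduces each parity case to smaller instances through the recursions for `2
* m` and `2 * m + 1`. -/
theorem lightCount_add_le (a b e : ℕ) (h : b ≤ a) :
    lightCount (a + b) e ≤ lightCount a e + lightCount b (e - 1) := by
  induction a using Nat.strong_induction_on generalizing b e with
  | _ a ih =>
  -- With `0 < b ≤ a`, the halves of `a` used below are strictly smaller than `a`.
  rcases Nat.eq_zero_or_pos b with rfl | hb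
  · simp [lightCount_zero_left]
  obtain ⟨p, rfl | rfl⟩ := Nat.even_or_odd' a <;> obtain ⟨q, rfl | rfl⟩ := Nat.even_or_odd' b
  · have h₁ := ih p (by omega) q e (by omega)
    have h₂ := ih p (by omega) q (e - 1) (by omega)
    rw [← mul_add]
    simp only [lightCount_two_mul]
    omega
  · have h₁ := ih p (by omega) (q + 1) e (by omega)
    have h₂ := ih p (by omega) q (e - 1) (by omega)
    rw [show 2 * p + (2 * q + 1) = 2 * (p + q) + 1 by ring]
    simp only [lightCount_two_mul, lightCount_two_mul_add_one]
    rw [add_assoc p q 1]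
    omega
  · have h₁ := ih (p + 1) (by omega) q e (by omega)
    have h₂ := ih p (by omega) q (e - 1) (by omega)
    rw [show 2 * p + 1 + 2 * q = 2 * (p + q) + 1 by ring]
    simp only [lightCount_two_mul, lightCount_two_mul_add_one]
    rw [show p + q + 1 = p + 1 + q by ring]
    omega
  · rw [show 2 * p + 1 + (2 * q + 1) = 2 * (p + q + 1) by ring]
    simp only [lightCount_two_mul, lightCount_two_mul_add_one]
    -- For `p = q` the bound is an equality. Otherwise the extra unit goes to `p` in one instance
    -- and to `q` in the other, and `lightCount_exchange` repairs the mismatch.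
    rcases (show q ≤ p by omega).eq_or_lt with rfl | hlt
    · rw [← two_mul]
      simp only [lightCount_two_mul_add_one]
      omega
    · have h₁ := ih (p + 1) (by omega) q e (by omega)
      have h₂ := ih p (by omega) (q + 1) (e - 1) (by omega)
      have h₃ := lightCount_exchange q (e - 1)
      rw [show p + 1 + q = p + q + 1 by ring] at h₁
      rw [show p + (q + 1) = p + q + 1 by ring] at h₂
      omega

theorem chooseLe_succ_succ (k d : ℕ) :
    chooseLe (k + 1) (d + 1) = chooseLe k (d + 1) + chooseLe k d := by
  unfold chooseLe
  rw [Finset.sum_range_succ' _ (d + 1), Finset.sum_range_succ' _ (d + 1)]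
  simp only [Nat.choose_succ_succ, Finset.sum_add_distrib, Nat.choose_zero_right]
  ring

theorem lightCount_two_pow (k d : ℕ) : lightCount (2 ^ k) (d + 1) = chooseLe k d := by
  induction k generalizing d with
  | zero => simp [lightCount_one, chooseLe, Finset.sum_range_succ']
  | succ k ih =>
    rw [pow_succ', lightCount_two_mul, ih]
    cases d with
    | zero => simp [lightCount_zero_right, chooseLe]
    | succ d => rw [chooseLe_succ_succ, Nat.add_sub_cancel, ih]

/-! ### Slicing and the lower bound on the Hilbert function. -/

/-- Rank-nullity for `D` restricted to `V`: `U` sits in the kernel and `W` in the image. -/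
theorem finrank_add_finrank_le_of_map {K M N : Type*} [Field K] [AddCommGroup M] [Module K M]
    [AddCommGroup N] [Module K N] [FiniteDimensional K M] [FiniteDimensional K N]
    (D : M →ₗ[K] N) {U V : Submodule K M} {W : Submodule K N}
    (hUV : U ≤ V) (hUD : U ≤ LinearMap.ker D) (hW : W ≤ V.map D) :
    Module.finrank K U + Module.finrank K W ≤ Module.finrank K V := by
  have h := LinearMap.finrank_range_add_finrank_ker (D.domRestrict V)
  rw [LinearMap.range_domRestrict] at h
  have h₁ : Module.finrank K U ≤ Module.finrank K (LinearMap.ker (D.domRestrict V)) := by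
    let i : U →ₗ[K] LinearMap.ker (D.domRestrict V) :=
      (Submodule.inclusion hUV).codRestrict _ fun u => hUD u.2
    refine LinearMap.finrank_le_finrank_of_injective (f := i) fun u v huv => ?_
    exact Subtype.ext (congrArg (fun w : LinearMap.ker (D.domRestrict V) => ((w : V) : M)) huv)
  have h₂ := Submodule.finrank_mono hW
  omega

/-- The union of the two slices of `S` in direction of the first coordinate. -/
def sliceUnion {n : ℕ} (S : Set (Fin (n + 1) → ZMod 2)) : Set (Fin n → ZMod 2) :=
  {y | (Fin.cons 0 y : Fin (n + 1) → ZMod 2) ∈ S} ∪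
    {y | (Fin.cons 1 y : Fin (n + 1) → ZMod 2) ∈ S}

/-- The intersection of the two slices of `S` in direction of the first coordinate. -/
def sliceInter {n : ℕ} (S : Set (Fin (n + 1) → ZMod 2)) : Set (Fin n → ZMod 2) :=
  {y | (Fin.cons 0 y : Fin (n + 1) → ZMod 2) ∈ S} ∩
    {y | (Fin.cons 1 y : Fin (n + 1) → ZMod 2) ∈ S}

theorem ZMod.two_eq_zero_or_one (c : ZMod 2) : c = 0 ∨ c = 1 := by
  revert c; decide

theorem ncard_sliceUnion_add_ncard_sliceInter {n : ℕ} (S : Set (Fin (n + 1) → ZMod 2)) :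
    (sliceUnion S).ncard + (sliceInter S).ncard = S.ncard := by
  unfold sliceUnion sliceInter
  rw [Set.ncard_union_add_ncard_inter]
  have hS : S = (fun y => (Fin.cons 0 y : Fin (n + 1) → ZMod 2)) ''
        {y | (Fin.cons 0 y : Fin (n + 1) → ZMod 2) ∈ S} ∪
      (fun y => (Fin.cons 1 y : Fin (n + 1) → ZMod 2)) ''
        {y | (Fin.cons 1 y : Fin (n + 1) → ZMod 2) ∈ S} := by
    ext x
    refine ⟨fun hx => ?_, ?_⟩
    · rw [← Fin.cons_self_tail x] at hx ⊢
      rcases ZMod.two_eq_zero_or_one (x 0) with h | h <;> rw [h] at hx ⊢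
      · exact Or.inl ⟨_, hx, rfl⟩
      · exact Or.inr ⟨_, hx, rfl⟩
    · rintro (⟨y, hy, rfl⟩ | ⟨y, hy, rfl⟩) <;> exact hy
  conv_rhs => rw [hS]
  have hinj (c : ZMod 2) :
      Function.Injective (fun y : Fin n → ZMod 2 => (Fin.cons c y : Fin (n + 1) → ZMod 2)) :=
    Fin.cons_right_injective (α := fun _ => ZMod 2) c
  rw [Set.ncard_union_eq, Set.ncard_image_of_injective _ (hinj 0),
    Set.ncard_image_of_injective _ (hinj 1)]
  rw [Set.disjoint_left]
  rintro _ ⟨y, -, rfl⟩ ⟨z, -, h⟩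
  have := congrFun h 0
  simp at this

theorem tail_mem_sliceUnion {n : ℕ} {S : Set (Fin (n + 1) → ZMod 2)} (x : S) :
    Fin.tail x.1 ∈ sliceUnion S := by
  have hx := x.2
  rw [← Fin.cons_self_tail x.1] at hx
  rcases ZMod.two_eq_zero_or_one (x.1 0) with h | h <;> rw [h] at hx
  · exact Or.inl hx
  · exact Or.inr hx

/-- Pullback of functions from the union of the slices to `S`. -/
def slicePullback {n : ℕ} (S : Set (Fin (n + 1) → ZMod 2)) :
    (sliceUnion S → ZMod 2) →ₗ[ZMod 2] (S → ZMod 2) :=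
  LinearMap.funLeft (ZMod 2) (ZMod 2) fun x => ⟨Fin.tail x.1, tail_mem_sliceUnion x⟩

theorem slicePullback_injective {n : ℕ} (S : Set (Fin (n + 1) → ZMod 2)) :
    Function.Injective (slicePullback S) := by
  refine LinearMap.funLeft_injective_of_surjective _ _ _ ?_
  rintro ⟨y, hy | hy⟩
  · exact ⟨⟨_, hy⟩, by simp⟩
  · exact ⟨⟨_, hy⟩, by simp⟩

/-- The difference of a function on `S` along the first coordinate. -/
def sliceDiff {n : ℕ} (S : Set (Fin (n + 1) → ZMod 2)) :
    (S → ZMod 2) →ₗ[ZMod 2] (sliceInter S → ZMod 2) :=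
  LinearMap.funLeft (ZMod 2) (ZMod 2) (fun y => (⟨Fin.cons 1 y.1, y.2.2⟩ : S)) -
    LinearMap.funLeft (ZMod 2) (ZMod 2) (fun y => (⟨Fin.cons 0 y.1, y.2.1⟩ : S))

theorem sliceDiff_comp_slicePullback {n : ℕ} (S : Set (Fin (n + 1) → ZMod 2))
    (g : sliceUnion S → ZMod 2) : sliceDiff S (slicePullback S g) = 0 := by
  ext y
  simp [sliceDiff, slicePullback, LinearMap.funLeft_apply]

theorem map_slicePullback_le {n : ℕ} (S : Set (Fin (n + 1) → ZMod 2)) (d : ℕ) :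
    ((MvPolynomial.restrictTotalDegree (Fin n) (ZMod 2) d).map
      (restrictTo (sliceUnion S))).map (slicePullback S) ≤
    (MvPolynomial.restrictTotalDegree (Fin (n + 1)) (ZMod 2) d).map (restrictTo S) := by
  rintro _ ⟨_, ⟨p, hp, rfl⟩, rfl⟩
  refine ⟨MvPolynomial.rename Fin.succ p, ?_, ?_⟩
  · rw [SetLike.mem_coe, MvPolynomial.mem_restrictTotalDegree] at hp ⊢
    exact (MvPolynomial.totalDegree_rename_le _ _).trans hp
  · ext x
    rw [slicePullback, LinearMap.funLeft_apply, restrictTo_apply, restrictTo_apply,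
      MvPolynomial.eval_rename]
    rfl

theorem le_map_sliceDiff {n : ℕ} (S : Set (Fin (n + 1) → ZMod 2)) (d : ℕ) :
    (MvPolynomial.restrictTotalDegree (Fin n) (ZMod 2) d).map (restrictTo (sliceInter S)) ≤
    ((MvPolynomial.restrictTotalDegree (Fin (n + 1)) (ZMod 2) (d + 1)).map
      (restrictTo S)).map (sliceDiff S) := by
  rintro _ ⟨q, hq, rfl⟩
  -- The factor `X 0` vanishes on the 0-slice and is 1 on the 1-slice, so the difference is `q`; it
  -- costs one degree.
  refine ⟨_, ⟨MvPolynomial.X 0 * MvPolynomial.rename Fin.succ q, ?_, rfl⟩, ?_⟩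
  · rw [SetLike.mem_coe, MvPolynomial.mem_restrictTotalDegree] at hq ⊢
    refine (MvPolynomial.totalDegree_mul _ _).trans ?_
    have := (MvPolynomial.totalDegree_rename_le (Fin.succ : Fin n → Fin (n + 1)) q).trans hq
    rw [MvPolynomial.totalDegree_X]
    omega
  · ext y
    simp only [sliceDiff, LinearMap.sub_apply, Pi.sub_apply, LinearMap.funLeft_apply,
      restrictTo_apply, map_mul, MvPolynomial.eval_X, MvPolynomial.eval_rename, Fin.cons_zero,
      one_mul, zero_mul, sub_zero]
    rfl

theorem hilbertFunction_sliceUnion_le {n : ℕ} (S : Set (Fin (n + 1) → ZMod 2)) (d : ℕ) :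
    hilbertFunction (sliceUnion S) d ≤ hilbertFunction S d := by
  unfold hilbertFunction
  rw [(Submodule.equivMapOfInjective _ (slicePullback_injective S) _).finrank_eq]
  exact Submodule.finrank_mono (map_slicePullback_le S d)

theorem hilbertFunction_slices_le {n : ℕ} (S : Set (Fin (n + 1) → ZMod 2)) (d : ℕ) :
    hilbertFunction (sliceUnion S) (d + 1) + hilbertFunction (sliceInter S) d ≤
      hilbertFunction S (d + 1) := by
  unfold hilbertFunction
  rw [(Submodule.equivMapOfInjective _ (slicePullback_injective S) _).finrank_eq]
  refine finrank_add_finrank_le_of_map (sliceDiff S) (map_slicePullback_le S _) ?_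
    (le_map_sliceDiff S d)
  rintro _ ⟨g, -, rfl⟩
  exact sliceDiff_comp_slicePullback S g

theorem hilbertFunction_pos {n : ℕ} {S : Set (Fin n → ZMod 2)} (hS : S.Nonempty) (d : ℕ) :
    0 < hilbertFunction S d := by
  obtain ⟨x, hx⟩ := hS
  unfold hilbertFunction
  rw [Module.finrank_pos_iff_exists_ne_zero]
  refine ⟨⟨restrictTo S 1, ⟨1, ?_, rfl⟩⟩, fun h => ?_⟩
  · rw [SetLike.mem_coe, MvPolynomial.mem_restrictTotalDegree]
    simp
  · have h' := congrFun (congrArg Subtype.val h) ⟨x, hx⟩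
    simp [restrictTo_apply] at h'

theorem lightCount_ncard_le_hilbertFunction {n : ℕ} (S : Set (Fin n → ZMod 2)) (d : ℕ) :
    lightCount S.ncard (d + 1) ≤ hilbertFunction S d := by
  induction n generalizing d with
  | zero =>
    rcases S.eq_empty_or_nonempty with rfl | hS
    · simp [lightCount_zero_left]
    · have h := Set.ncard_le_one_of_subsingleton S
      exact (lightCount_mono h _).trans ((lightCount_one d).le.trans (hilbertFunction_pos hS d))
  | succ n ih =>
    have h := lightCount_add_le (sliceUnion S).ncard (sliceInter S).ncard (d + 1)
      (Set.ncard_le_ncard (fun y hy => Or.inl hy.1))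
    rw [ncard_sliceUnion_add_ncard_sliceInter, Nat.add_sub_cancel] at h
    have hA := ih (sliceUnion S) d
    cases d with
    -- In degree 0 the intersection contributes nothing, so the union alone suffices.
    | zero =>
      rw [lightCount_zero_right] at h
      have := hilbertFunction_sliceUnion_le S 0
      omega
    | succ d =>
      have hB := ih (sliceInter S) d
      have := hilbertFunction_slices_le S d
      omega

theorem chooseLe_le_hilbertFunction {n k : ℕ} {S : Set (Fin n → ZMod 2)} (h : 2 ^ k ≤ S.ncard)
    (d : ℕ) : chooseLe k d ≤ hilbertFunction S d := by
  rw [← lightCount_two_pow]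
  exact (lightCount_mono h _).trans (lightCount_ncard_le_hilbertFunction S d)

/-! ### Reduction to multilinear polynomials. -/

theorem finsupp_prod_min_one_pow {σ : Type*} (s : σ →₀ ℕ) (x : σ → ZMod 2) :
    ((s.mapRange (min 1) rfl).prod fun i e => x i ^ e) = s.prod fun i e => x i ^ e := by
  rw [Finsupp.prod_mapRange_index (fun i => pow_zero _)]
  refine Finsupp.prod_congr fun i hi => ?_
  have hs := Nat.one_le_iff_ne_zero.2 (Finsupp.mem_support_iff.1 hi)
  rw [min_eq_left hs, pow_one]
  rcases ZMod.two_eq_zero_or_one (x i) with h | h <;> rw [h]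
  · rw [zero_pow (by omega)]
  · rw [one_pow]

theorem exists_lowDegreePoly_eval_eq {n d : ℕ} {p : MvPolynomial (Fin n) (ZMod 2)}
    (hp : p.totalDegree ≤ d) :
    ∃ q ∈ lowDegreePoly (ZMod 2) n d, ∀ x, MvPolynomial.eval x q = MvPolynomial.eval x p := by
  -- Since `x ^ e = x` on `ZMod 2` for `e ≥ 1`, every exponent is truncated to at most 1.
  refine ⟨∑ s ∈ p.support, MvPolynomial.monomial (s.mapRange (min 1) rfl) (p.coeff s),
    Submodule.sum_mem _ fun s hs => ⟨?_, ?_⟩, fun x => ?_⟩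
  · rw [SetLike.mem_coe, MvPolynomial.mem_restrictTotalDegree]
    refine (MvPolynomial.totalDegree_monomial_le _ _).trans
      (le_trans ?_ ((MvPolynomial.le_totalDegree hs).trans hp))
    rw [Finsupp.sum_mapRange_index (fun _ => rfl)]
    exact Finset.sum_le_sum fun i _ => min_le_right _ _
  · rw [SetLike.mem_coe, MvPolynomial.mem_restrictDegree]
    intro t ht i
    rw [Finset.mem_singleton.1 (MvPolynomial.support_monomial_subset ht), ZMod.card]
    exact min_le_left _ _
  · conv_rhs => rw [p.as_sum]
    simp only [map_sum, MvPolynomial.eval_monomial, finsupp_prod_min_one_pow]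

theorem map_lowDegreePoly {n : ℕ} (S : Set (Fin n → ZMod 2)) (d : ℕ) :
    (lowDegreePoly (ZMod 2) n d).map (restrictTo S) =
      (MvPolynomial.restrictTotalDegree (Fin n) (ZMod 2) d).map (restrictTo S) := by
  refine le_antisymm (Submodule.map_mono inf_le_left) ?_
  rintro _ ⟨p, hp, rfl⟩
  rw [SetLike.mem_coe, MvPolynomial.mem_restrictTotalDegree] at hp
  obtain ⟨q, hq, hqp⟩ := exists_lowDegreePoly_eval_eq hp
  refine ⟨q, hq, ?_⟩
  ext x
  rw [restrictTo_apply, restrictTo_apply, hqp]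

/-! ### Fibres of linear maps and probabilities of random polynomials. -/

theorem natCard_fiber_mul_pow_finrank_range_le {K V W : Type*} [Field K] [Finite K]
    [AddCommGroup V] [Module K V] [Finite V] [AddCommGroup W] [Module K W]
    (φ : V →ₗ[K] W) (w : W) :
    Nat.card {v // φ v = w} * Nat.card K ^ Module.finrank K (LinearMap.range φ) ≤ Nat.card V := by
  have hker : Nat.card {v // φ v = w} ≤ Nat.card (LinearMap.ker φ) := by
    rcases isEmpty_or_nonempty {v // φ v = w} with h | ⟨⟨v₀, hv₀⟩⟩
    · simp
    -- Translating by a fixed point `v₀` of the fibre embeds it in the kernel.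
    · refine Nat.card_le_card_of_injective
        (fun v => (⟨v.1 - v₀, by simp [v.2, hv₀]⟩ : LinearMap.ker φ)) fun u v huv => ?_
      exact Subtype.ext (sub_left_injective (congrArg Subtype.val huv))
  have : Module.Finite K V := Module.Finite.of_finite
  rw [Module.natCard_eq_pow_finrank (K := K) (V := V), ← LinearMap.finrank_range_add_finrank_ker φ,
    add_comm, pow_add, ← Module.natCard_eq_pow_finrank (K := K) (V := LinearMap.ker φ)]
  exact Nat.mul_le_mul_right _ hker

open Classical in
theorem prRandomPoly_eq_card_div (F : Type*) [Field F] [Fintype F] (n d : ℕ)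
    (P : MvPolynomial (Fin n) F → Prop) :
    prRandomPoly F n d P = ((Finset.univ.filter fun p : lowDegreePoly F n d => P p).card : ℝ) /
      Fintype.card (lowDegreePoly F n d) := by
  unfold prRandomPoly
  rw [PMF.toOuterMeasure_uniformOfFintype_apply, ENNReal.toReal_div, ENNReal.toReal_natCast,
    ENNReal.toReal_natCast, Fintype.card_subtype]
  simp

theorem prRandomPoly_mono (F : Type*) [Field F] [Fintype F] (n d : ℕ)
    {P Q : MvPolynomial (Fin n) F → Prop} (h : ∀ p, P p → Q p) :
    prRandomPoly F n d P ≤ prRandomPoly F n d Q := by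
  classical
  rw [prRandomPoly_eq_card_div, prRandomPoly_eq_card_div]
  gcongr with p
  exact h p

theorem prRandomPoly_or_le (F : Type*) [Field F] [Fintype F] (n d : ℕ)
    (P Q : MvPolynomial (Fin n) F → Prop) :
    prRandomPoly F n d (fun p => P p ∨ Q p) ≤ prRandomPoly F n d P + prRandomPoly F n d Q := by
  classical
  rw [prRandomPoly_eq_card_div, prRandomPoly_eq_card_div, prRandomPoly_eq_card_div, ← add_div]
  gcongr
  norm_cast
  refine (Finset.card_le_card fun p hp => ?_).trans (Finset.card_union_le _ _)
  simpa using hp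

theorem prRandomPoly_exists_le (F : Type*) [Field F] [Fintype F] (n d : ℕ) {ι : Type*}
    (s : Finset ι) (P : ι → MvPolynomial (Fin n) F → Prop) :
    prRandomPoly F n d (fun p => ∃ i ∈ s, P i p) ≤ ∑ i ∈ s, prRandomPoly F n d (P i) := by
  classical
  induction s using Finset.induction_on with
  | empty => simp [prRandomPoly]
  | insert i s hi ih =>
    rw [Finset.sum_insert hi]
    simp only [Finset.exists_mem_insert]
    exact (prRandomPoly_or_le F n d _ _).trans (by gcongr)

theorem prRandomPoly_add_not (F : Type*) [Field F] [Fintype F] (n d : ℕ)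
    (P : MvPolynomial (Fin n) F → Prop) :
    prRandomPoly F n d P + prRandomPoly F n d (fun p => ¬ P p) = 1 := by
  classical
  rw [prRandomPoly_eq_card_div, prRandomPoly_eq_card_div, ← add_div, ← Nat.cast_add,
    Finset.card_filter_add_card_filter_not, Finset.card_univ, div_self]
  exact_mod_cast Fintype.card_ne_zero

theorem prRandomPoly_restrictTo_eq_le {n : ℕ} (d : ℕ) (S : Set (Fin n → ZMod 2))
    (f : S → ZMod 2) :
    prRandomPoly (ZMod 2) n d (fun p => restrictTo S p = f) ≤
      (2 : ℝ) ^ (-(hilbertFunction S d : ℤ)) := by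
  classical
  have h := natCard_fiber_mul_pow_finrank_range_le
    ((restrictTo S).domRestrict (lowDegreePoly (ZMod 2) n d)) f
  rw [LinearMap.range_domRestrict, map_lowDegreePoly, Nat.card_zmod,
    ← Nat.cast_le (α := ℝ), Nat.cast_mul, Nat.cast_pow, Nat.cast_ofNat] at h
  rw [prRandomPoly_eq_card_div, zpow_neg, zpow_natCast, ← one_div, ← Fintype.card_subtype,
    ← Nat.card_eq_fintype_card, ← Nat.card_eq_fintype_card,
    div_le_div_iff₀ (Nat.cast_pos.2 Nat.card_pos) (by positivity), one_mul]
  exact h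

/-! ### Min-entropy and dispersers. -/

/-- Each atom has mass at most `2 ^ (-k)` and the total mass is 1. -/
theorem two_pow_le_ncard_support {α : Type*} [Fintype α] {X : PMF α} {k : ℕ}
    (hX : (k : ℝ) ≤ minEntropy X) : 2 ^ k ≤ X.support.ncard := by
  classical
  have hle (x : α) (hx : x ∈ X.support) : (X x).toReal ≤ ((2 : ℝ) ^ k)⁻¹ := by
    have h : (k : ℝ) ≤ -Real.logb 2 (X x).toReal :=
      hX.trans (ciInf_le (f := fun x : X.support => -Real.logb 2 (X x).toReal)
        (Set.finite_range _).bddBelow ⟨x, hx⟩)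
    have hpos : 0 < (X x).toReal :=
      ENNReal.toReal_pos ((PMF.mem_support_iff _ _).1 hx) (X.apply_ne_top x)
    rw [← Real.rpow_natCast, ← Real.rpow_neg zero_le_two,
      ← Real.logb_le_iff_le_rpow one_lt_two hpos]
    linarith
  have hsum : ∑ x ∈ X.support.toFinset, (X x).toReal = 1 := by
    rw [← ENNReal.toReal_sum fun x _ => X.apply_ne_top x,
      ← tsum_eq_sum (L := .unconditional α) (fun x hx => by simpa using hx), X.tsum_coe,
      ENNReal.toReal_one]
  have h := Finset.sum_le_card_nsmul X.support.toFinset (fun x => (X x).toReal) _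
    fun x hx => hle x (Set.mem_toFinset.1 hx)
  rw [hsum, nsmul_eq_mul, ← div_eq_mul_inv, le_div_iff₀ (by positivity), one_mul,
    ← Set.ncard_eq_toFinset_card'] at h
  exact_mod_cast h

theorem prRandomPoly_restrictTo_eq_le_chooseLe {n k : ℕ} (d : ℕ) {S : Set (Fin n → ZMod 2)}
    (hS : 2 ^ k ≤ S.ncard) (f : S → ZMod 2) :
    prRandomPoly (ZMod 2) n d (fun p => restrictTo S p = f) ≤
      (2 : ℝ) ^ (-(chooseLe k d : ℤ)) := by
  refine (prRandomPoly_restrictTo_eq_le d S f).trans (zpow_le_zpow_right₀ one_le_two ?_)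
  exact neg_le_neg (by exact_mod_cast chooseLe_le_hilbertFunction hS d)

theorem restrictTo_eq_zero_or_one_of_support_map_ne {n : ℕ} {X : PMF (Fin n → ZMod 2)}
    {p : MvPolynomial (Fin n) (ZMod 2)}
    (h : (X.map fun x => MvPolynomial.eval x p).support ≠ {0, 1}) :
    restrictTo X.support p = 0 ∨ restrictTo X.support p = 1 := by
  contrapose! h
  obtain ⟨⟨x, hx⟩, ⟨y, hy⟩⟩ := And.imp Function.ne_iff.1 Function.ne_iff.1 h
  rw [restrictTo_apply] at hx hy
  rw [PMF.support_map]
  refine Set.Subset.antisymm (fun c _ => ZMod.two_eq_zero_or_one c) ?_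
  rintro c (rfl | rfl)
  · exact ⟨y, y.2, (ZMod.two_eq_zero_or_one _).resolve_right hy⟩
  · exact ⟨x, x.2, (ZMod.two_eq_zero_or_one _).resolve_left hx⟩

theorem one_sub_le_prRandomPoly_isDisperser {n k : ℕ} (d : ℕ)
    {𝒳 : Set (PMF (Fin n → ZMod 2))} (hfin : 𝒳.Finite)
    (hent : ∀ X ∈ 𝒳, (k : ℝ) ≤ minEntropy X) :
    1 - (𝒳.ncard : ℝ) * (2 : ℝ) ^ (1 - (chooseLe k d : ℤ)) ≤
      prRandomPoly (ZMod 2) n d (fun p => IsDisperser (fun x => MvPolynomial.eval x p) 𝒳) := by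
  rw [← prRandomPoly_add_not (ZMod 2) n d
    (fun p => IsDisperser (fun x => MvPolynomial.eval x p) 𝒳), sub_le_iff_le_add]
  gcongr
  calc prRandomPoly (ZMod 2) n d (fun p => ¬ IsDisperser (fun x => MvPolynomial.eval x p) 𝒳)
      ≤ prRandomPoly (ZMod 2) n d (fun p => ∃ X ∈ hfin.toFinset,
          (restrictTo X.support p = 0 ∨ restrictTo X.support p = 1)) := by
        refine prRandomPoly_mono _ _ _ fun p hp => ?_
        unfold IsDisperser at hp
        push Not at hp
        obtain ⟨X, hX, h⟩ := hp
        exact ⟨X, hfin.mem_toFinset.2 hX, restrictTo_eq_zero_or_one_of_support_map_ne h⟩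
    _ ≤ ∑ X ∈ hfin.toFinset, prRandomPoly (ZMod 2) n d
          (fun p => restrictTo X.support p = 0 ∨ restrictTo X.support p = 1) :=
        prRandomPoly_exists_le _ _ _ _ _
    _ ≤ ∑ X ∈ hfin.toFinset, (2 : ℝ) ^ (1 - (chooseLe k d : ℤ)) := by
        refine Finset.sum_le_sum fun X hX => (prRandomPoly_or_le _ _ _ _ _).trans ?_
        have hS := two_pow_le_ncard_support (hent X (hfin.mem_toFinset.1 hX))
        -- The extra factor 2 accounts for the two constants 0 and 1.
        rw [sub_eq_add_neg, zpow_add₀ two_ne_zero, zpow_one, two_mul]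
        exact add_le_add (prRandomPoly_restrictTo_eq_le_chooseLe d hS 0)
          (prRandomPoly_restrictTo_eq_le_chooseLe d hS 1)
    _ = (𝒳.ncard : ℝ) * (2 : ℝ) ^ (1 - (chooseLe k d : ℤ)) := by
        rw [Finset.sum_const, nsmul_eq_mul, Set.ncard_eq_toFinset_card 𝒳 hfin]

theorem mainTheorem9 (n d : ℕ) (hn : 1 ≤ n) (hd : 1 ≤ d) :
    (∀ S : Set (Fin n → ZMod 2), S.Nonempty → ∀ f : S → ZMod 2,
      prRandomPoly (ZMod 2) n d (fun p => restrictTo S p = f)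
          ≤ (2 : ℝ) ^ (-(hilbertFunction S d : ℤ)) ∧
        (2 : ℝ) ^ (-(hilbertFunction S d : ℤ))
          ≤ (2 : ℝ) ^ (-(chooseLe (Nat.log 2 S.ncard) d : ℤ))) ∧
    (∀ k : ℕ, 1 ≤ k → ∀ 𝒳 : Set (PMF (Fin n → ZMod 2)), 𝒳.Finite →
      (∀ X ∈ 𝒳, (k : ℝ) ≤ minEntropy X) →
      1 - (𝒳.ncard : ℝ) * (2 : ℝ) ^ (1 - (chooseLe k d : ℤ))
        ≤ prRandomPoly (ZMod 2) n d
            (fun p => IsDisperser (fun x => MvPolynomial.eval x p) 𝒳)) := by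
  refine ⟨fun S hS f => ⟨prRandomPoly_restrictTo_eq_le d S f, ?_⟩,
    fun k _ 𝒳 hfin hent => one_sub_le_prRandomPoly_isDisperser d hfin hent⟩
  have hlog : 2 ^ Nat.log 2 S.ncard ≤ S.ncard :=
    Nat.pow_log_le_self 2 ((Set.ncard_pos (Set.toFinite S)).2 hS).ne'
  refine zpow_le_zpow_right₀ one_le_two (neg_le_neg ?_)
  exact_mod_cast chooseLe_le_hilbertFunction hlog d
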